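/- **Corollary (fleet Bayesian regret of batched Thompson Sampling).** *Setting.* Let $\mathcal G=(\mathcal V,\mathcal E)$ be a directed graph without loops and with a finite edge set, with a source vertex $u$ and a target vertex $v$. A path is a sequence of vertices $\langle u_1,\dots,u_n\rangle$, $n\ge 1$, with $u_1=u$, $u_n=v$ and $(u_h,u_{h+1})\in\mathcal E$ for all $h<n$; it is identified with the set of edges that it traverses. Let $\mathcal I$ be a nonempty set of (edge sets of) such paths, for instance all of them, or all simple ones. Each edge $e$ has an unknown parameter $\theta^*_e\sim\mathcal N(\mu_{e,0},\varsigma_{e,0}^2)$ with $\varsigma_{e,0}>0$, independently over edges, and each time a vehicle traverses $e$ a reward is observed that is distributed, independently given $\theta^*$, as $\mathcal N(\theta^*_e,\sigma_e^2)$, with known $0<\sigma_e\le 1$. The expected reward of $\boldsymbol a\in\mathcal I$ under $\theta$ is $f_\theta(\boldsymbol a)=\sum_{e\in\boldsymbol a}h_e(\theta_e)$, where either $h_e(\theta)=\theta$ for all $e$ (Gaussian model) or $h_e(\theta)=-\mathbb E[\max(0,x)]$ with $x\sim\mathcal N(-\theta,\sigma_e^2)$ for all $e$ (rectified Gaussian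 model). *Algorithm.* Each edge has been played once initially; these plays are observed and do not count in the regret. At each step $t=1,\dots,T$, each of $K$ vehicles $k$ independently samples $\tilde\theta_{t,k}$ from the Gaussian posterior distribution of $\theta^*$ given all observations made by all vehicles before step $t$ (including the initial ones), and plays $\boldsymbol a_{t,k}\in\arg\max_{\boldsymbol a\in\mathcal I}f_{\tilde\theta_{t,k}}(\boldsymbol a)$, chosen by a fixed measurable rule. At the end of the step the rewards observed on all traversed edges are shared by all vehicles. *Claim.* Let $\mathrm{BayesRegret}_k(T)=\mathbb E\big[\sum_{t=1}^T\big(\max_{\boldsymbol a\in\mathcal I}f_{\theta^*}(\boldsymbol a)-f_{\theta^*}(\boldsymbol a_{t,k})\big)\big]$. These expectations are of integrable random variables, and $$\sum_{k=1}^K\mathrm{BayesRegret}_k(T)\le\tilde{\mathcal O}\big(|\mathcal E|\,K+|\mathcal E|\sqrt{TK}\big),$$ that is, there are absolute constants $C$ and $p$ (independent of the graph, $\mathcal I$, $K$, $T$, the prior, the noise levels and the tie-breaking rule) such that the left side is at most $C\,(1+\log(TK))^p\,\big(|\mathcal E|K+|\mathcal E|\sqrt{TK}\big)$, where $\log 0$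 is read as $0$. -/

import Mathlib

open MeasureTheory ProbabilityTheory
open scoped BigOperators Classical

noncomputable section

namespace FleetRouting

/-! ### Road networks and paths -/

/-- A directed road network with a finite set of edges (ordered pairs of distinct vertices) and a
common source and target vertex for all vehicles. -/
structure RoadNetwork (V : Type*) where
  edges : Finset (V × V)
  ne_of_mem : ∀ e ∈ edges, e.1 ≠ e.2
  source : V
  target : V

namespace RoadNetwork

variable {V : Type*}

/-- The edges of the network; they are the base arms of the bandit problem. -/
abbrev Edge (G : RoadNetwork V) : Type _ := {e : V × V // e ∈ G.edges}

/-- A directed path from the source to the target: a sequence of vertices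
`⟨u₁, …, uₙ⟩`, `n ≥ 1`, with `(u_h, u_{h+1})` an edge for `h = 1, …, n - 1`. -/
def IsPath (G : RoadNetwork V) (p : List V) : Prop :=
  p.head? = some G.source ∧ p.getLast? = some G.target ∧
    p.IsChain (fun u v => (u, v) ∈ G.edges)

/-- The set of edges `(u_h, u_{h+1})` traversed by a sequence of vertices. -/
def edgeSet (G : RoadNetwork V) (p : List V) : Finset G.Edge :=
  Finset.univ.filter fun e => (e : V × V) ∈ p.zip p.tail

/-- The super-arms given by the paths from the source to the target. -/
def pathArms (G : RoadNetwork V) : Finset (Finset G.Edge) :=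
  Finset.univ.filter fun a => ∃ p : List V, G.IsPath p ∧ G.edgeSet p = a

end RoadNetwork

/-! ### Gaussian combinatorial semi-bandits -/

/-- How the expected reward of a base arm depends on its unknown parameter. -/
inductive RewardModel
  | gaussian
  | rectified

/-- The expected reward of a base arm with parameter `θ` and noise standard deviation `s`: either
`θ` itself, or `-𝔼[max(0, x)]` with `x ∼ 𝒩(-θ, s²)` (the rectified energy consumption). -/
def RewardModel.meanReward (m : RewardModel) (s θ : ℝ) : ℝ :=
  match m with
  | .gaussian => θ
  | .rectified => -∫ x, max 0 x ∂(gaussianReal (-θ) ⟨s ^ 2, sq_nonneg s⟩)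

/-- Data of a combinatorial semi-bandit with base arms `A`: the feasible super-arms, the prior
`𝒩(priorMean i, (priorSD i)²)` of the unknown parameter of base arm `i`, and the standard
deviation `noiseSD i` of the observations of base arm `i`. -/
structure SemiBandit (A : Type*) where
  model : RewardModel
  arms : Finset (Finset A)
  priorMean : A → ℝ
  priorSD : A → ℝ
  noiseSD : A → ℝ

/-- The independent sources of randomness, for `K` agents: the draw of the unknown parameters, the
noise in the initial observation of each base arm, the noise in the observation of each base arm
by agent `k` at step `t`, and the randomization used by agent `k` at step `t` to sample from the
posterior distribution. -/
inductive Noise (A : Type*) (K : ℕ)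
  | prior (i : A)
  | init (i : A)
  | obs (t : ℕ) (k : Fin K) (i : A)
  | post (t : ℕ) (k : Fin K) (i : A)

/-- Sample space. -/
abbrev Outcome (A : Type*) (K : ℕ) : Type _ := Noise A K → ℝ

/-- All sources of randomness are independent standard Gaussians. -/
def law (A : Type*) (K : ℕ) : Measure (Outcome A K) :=
  Measure.infinitePi fun _ : Noise A K => gaussianReal 0 1

/-- The information about the base arms that the posterior depends on: for each base arm,
the number of plays so far and the sum of the observed rewards. -/
structure Stats (A : Type*) where
  count : A → ℕ
  total : A → ℝ

namespace SemiBandit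

variable {A : Type*} {K : ℕ}

/-- The expected reward `f_θ(a)` of the super-arm `a`. -/
def expReward (M : SemiBandit A) (θ : A → ℝ) (a : Finset A) : ℝ :=
  ∑ i ∈ a, M.model.meanReward (M.noiseSD i) (θ i)

/-- `oracle` is an exact (and measurable) solver of the optimization problem
`argmax_{a ∈ arms} f_θ(a)`, with arbitrary tie-breaking. -/
structure IsOracle (M : SemiBandit A) (oracle : (A → ℝ) → Finset A) : Prop where
  mem : ∀ θ, oracle θ ∈ M.arms
  le : ∀ θ, ∀ a ∈ M.arms, M.expReward θ a ≤ M.expReward θ (oracle θ)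
  measurable : ∀ a, MeasurableSet (oracle ⁻¹' {a})

/-- The true parameters `θ*_i ∼ 𝒩(priorMean i, (priorSD i)²)`. -/
def trueParam (M : SemiBandit A) (ω : Outcome A K) (i : A) : ℝ :=
  M.priorMean i + M.priorSD i * ω (.prior i)

/-- The reward, distributed as `𝒩(θ*_i, (noiseSD i)²)` given `θ*`, of the one initial play of base
arm `i`. -/
def initReward (M : SemiBandit A) (ω : Outcome A K) (i : A) : ℝ :=
  M.trueParam ω i + M.noiseSD i * ω (.init i)

/-- The reward, distributed as `𝒩(θ*_i, (noiseSD i)²)` given `θ*`, that base arm `i` yields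
to agent `k` at step `t` if that agent plays it. -/
def reward (M : SemiBandit A) (ω : Outcome A K) (t : ℕ) (k : Fin K) (i : A) : ℝ :=
  M.trueParam ω i + M.noiseSD i * ω (.obs t k i)

/-- Variance of the Gaussian posterior of `θ*_i` given the observations. -/
def postVar (M : SemiBandit A) (s : Stats A) (i : A) : ℝ :=
  (1 / M.priorSD i ^ 2 + s.count i / M.noiseSD i ^ 2)⁻¹

/-- Mean of the Gaussian posterior of `θ*_i` given the observations. -/
def postMean (M : SemiBandit A) (s : Stats A) (i : A) : ℝ :=
  M.postVar s i * (M.priorMean i / M.priorSD i ^ 2 + s.total i / M.noiseSD i ^ 2)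

/-- The parameters sampled by agent `k` at step `t` from the posterior with statistics `s`. -/
def sample (M : SemiBandit A) (ω : Outcome A K) (s : Stats A) (t : ℕ) (k : Fin K) (i : A) : ℝ :=
  M.postMean s i + √(M.postVar s i) * ω (.post t k i)

/-- The shared statistics after `t` steps of batched Thompson sampling. At first each base arm
has been played once. In a step, each of the `K` agents samples from the posterior given
all observations of the preceding steps, and plays an optimal super-arm for its
sample; then the rewards of the played base arms are shared by all agents. -/
def stats (M : SemiBandit A) (oracle : (A → ℝ) → Finset A) (ω : Outcome A K) : ℕ → Stats A
  | 0 => ⟨fun _ => 1, M.initReward ω⟩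
  | t + 1 =>
    let s := M.stats oracle ω t
    let a : Fin K → Finset A := fun k => oracle (M.sample ω s t k)
    ⟨fun i => s.count i + (Finset.univ.filter fun k => i ∈ a k).card,
      fun i => s.total i + ∑ k, if i ∈ a k then M.reward ω t k i else 0⟩

/-- The super-arm played by agent `k` at step `t` (steps are numbered `0, 1, 2, …`). -/
def action (M : SemiBandit A) (oracle : (A → ℝ) → Finset A) (t : ℕ) (k : Fin K)
    (ω : Outcome A K) : Finset A :=
  oracle (M.sample ω (M.stats oracle ω t) t k)

/-- The regret of agent `k` over `T` steps against the optimal super-arm `oracle θ*`. -/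
def regret (M : SemiBandit A) (oracle : (A → ℝ) → Finset A) (T : ℕ) (k : Fin K)
    (ω : Outcome A K) : ℝ :=
  ∑ t ∈ Finset.range T,
    (M.expReward (M.trueParam ω) (oracle (M.trueParam ω)) -
      M.expReward (M.trueParam ω) (M.action oracle t k ω))

/-- The Bayesian regret of agent `k` (of `K`) over `T` steps. -/
def bayesRegret (M : SemiBandit A) (oracle : (A → ℝ) → Finset A) (T : ℕ) (k : Fin K) : ℝ :=
  ∫ ω, M.regret oracle T k ω ∂(law A K)

end SemiBandit

end FleetRouting

end

noncomputable section

namespace FleetRouting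

/-! ### Standard Gaussian vectors -/

/-! Thompson sampling draws from the exact posterior, so a sample `θ̃` has the same law as `θ*`, and
the optimal value has the same expectation as the value of the played super-arm under its own
sample. Mean rewards are 1-Lipschitz in the parameter, so the expected regret of one agent in one
step is at most the expectation of `∑ |θ̃_i - θ*_i|` over the played base arms. Both parameters
equal the posterior mean plus the posterior standard deviation times a standard Gaussian. Truncating
these Gaussians at level `L` bounds each term by `2 * L` standard deviations plus an excess of order
`exp (-L)` in expectation.

Since `noiseSD ≤ 1`, the standard deviation after `N` plays is at most `1 / √N`. A batch can raise
`N` by up to `K` at frozen statistics, yet a telescoping argument (`sum_div_sqrt_le`) bounds the sum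
of the widths over all plays of an arm by `K + 2 * √(T * K)` on every trajectory. Summing over edges
with `L = log (T * K)` gives the bound (`sum_bayesRegret_le`).

The delicate point is that the Gaussian formulas give the posterior although plays are chosen
adaptively. It is expressed without conditional distributions: the standardized position of `θ*` is
a standard Gaussian vector independent of the statistics (`map_stats_zscore`). This is preserved by
each round: once the old statistics and the randomization are fixed, so are the super-arms, and the
new standardized position is a family of orthonormal linear forms orthogonal to those that determine
the new statistics (`map_update_zscore`). -/

/-- The law of a vector of independent standard Gaussians. -/
abbrev gaussianPi (ι : Type*) [Fintype ι] : Measure (ι → ℝ) :=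
  Measure.pi fun _ : ι => gaussianReal 0 1

section GaussianPi

variable {ι J I : Type*} [Fintype ι] [Fintype J] [Fintype I]

lemma iIndepFun_eval_gaussianPi : iIndepFun (fun (i : ι) (x : ι → ℝ) => x i) (gaussianPi ι) :=
  iIndepFun_pi (X := fun _ : ι => id) fun _ => aemeasurable_id

lemma map_eval_gaussianPi (i : ι) : (gaussianPi ι).map (fun x => x i) = gaussianReal 0 1 :=
  (measurePreserving_eval (fun _ : ι => gaussianReal 0 1) i).map_eq

lemma hasGaussianLaw_eval_gaussianPi (i : ι) :
    HasGaussianLaw (fun x : ι → ℝ => x i) (gaussianPi ι) :=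
  ⟨by rw [map_eval_gaussianPi]; infer_instance⟩

lemma hasGaussianLaw_gaussianPi : HasGaussianLaw (fun x : ι → ℝ => x) (gaussianPi ι) :=
  iIndepFun_eval_gaussianPi.hasGaussianLaw hasGaussianLaw_eval_gaussianPi

lemma covariance_eval_gaussianPi (i j : ι) :
    cov[fun x : ι → ℝ => x i, fun x => x j; gaussianPi ι] = if i = j then 1 else 0 := by
  split_ifs with h
  · subst h
    rw [covariance_self (measurable_pi_apply i).aemeasurable]
    have : HasLaw (fun x : ι → ℝ => x i) (gaussianReal 0 1) (gaussianPi ι) :=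
      ⟨(measurable_pi_apply i).aemeasurable, map_eval_gaussianPi i⟩
    rw [this.variance_eq]
    simp
  · exact (iIndepFun_eval_gaussianPi.indepFun h).covariance_eq_zero
      (hasGaussianLaw_eval_gaussianPi i).memLp_two (hasGaussianLaw_eval_gaussianPi j).memLp_two

lemma covariance_linear_gaussianPi (u v : ι → ℝ) :
    cov[fun x : ι → ℝ => ∑ l, u l * x l, fun x => ∑ l, v l * x l; gaussianPi ι] =
      ∑ l, u l * v l := by
  have hm (w : ι → ℝ) (l : ι) : MemLp (fun x : ι → ℝ => w l * x l) 2 (gaussianPi ι) :=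
    (hasGaussianLaw_eval_gaussianPi l).memLp_two.const_mul _
  rw [covariance_fun_sum_fun_sum (hm u) (hm v)]
  simp [covariance_const_mul_left, covariance_const_mul_right, covariance_eval_gaussianPi, mul_comm]

/-- Joint Gaussianity of the two families is what turns vanishing covariances into independence. -/
lemma hasGaussianLaw_linear_gaussianPi (u : J → ι → ℝ) (v : I → ι → ℝ) :
    HasGaussianLaw (fun x : ι → ℝ => (fun j => ∑ l, u j l * x l, fun i => ∑ l, v i l * x l))
      (gaussianPi ι) := by
  have := hasGaussianLaw_gaussianPi.map_fun (ContinuousLinearMap.prod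
    (ContinuousLinearMap.pi fun j => ∑ l, u j l •
      ContinuousLinearMap.proj (R := ℝ) (φ := fun _ : ι => ℝ) l)
    (ContinuousLinearMap.pi fun i => ∑ l, v i l •
      ContinuousLinearMap.proj (R := ℝ) (φ := fun _ : ι => ℝ) l))
  convert! this using 2 with x
  simp

lemma integral_linear_gaussianPi (v : ι → ℝ) :
    ∫ x, ∑ l, v l * x l ∂(gaussianPi ι) = 0 := by
  rw [integral_finsetSum _ fun l _ => (hasGaussianLaw_eval_gaussianPi l).integrable.const_mul _]
  refine Finset.sum_eq_zero fun l _ => ?_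
  have : HasLaw (fun x : ι → ℝ => x l) (gaussianReal 0 1) (gaussianPi ι) :=
    ⟨(measurable_pi_apply l).aemeasurable, map_eval_gaussianPi l⟩
  rw [integral_const_mul, this.integral_eq]
  simp

/-- Linear forms `v i` of a standard Gaussian vector that are orthonormal, and orthogonal to the
linear forms `u j`, are independent standard Gaussians, independent of the forms `u j`. -/
theorem map_linear_gaussianPi_eq_prod (u : J → ι → ℝ) (v : I → ι → ℝ)
    (huv : ∀ j i, ∑ l, u j l * v i l = 0)
    (hvv : ∀ i i', ∑ l, v i l * v i' l = if i = i' then 1 else 0) :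
    (gaussianPi ι).map (fun x => (fun j => ∑ l, u j l * x l, fun i => ∑ l, v i l * x l)) =
      ((gaussianPi ι).map fun x j => ∑ l, u j l * x l).prod (gaussianPi I) := by
  have hG := hasGaussianLaw_linear_gaussianPi u v
  have hV : HasGaussianLaw (fun (x : ι → ℝ) i => ∑ l, v i l * x l) (gaussianPi ι) := hG.snd
  have hind : IndepFun (fun (x : ι → ℝ) j => ∑ l, u j l * x l)
      (fun (x : ι → ℝ) i => ∑ l, v i l * x l) (gaussianPi ι) :=
    HasGaussianLaw.indepFun_of_covariance_eval (X := fun j (x : ι → ℝ) => ∑ l, u j l * x l)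
      (Y := fun i (x : ι → ℝ) => ∑ l, v i l * x l) hG fun j i => by
        rw [covariance_linear_gaussianPi, huv]
  rw [(indepFun_iff_map_prod_eq_prod_map_map hG.fst.aemeasurable hV.aemeasurable).1 hind]
  congr 1
  have hiind : iIndepFun (fun i (x : ι → ℝ) => ∑ l, v i l * x l) (gaussianPi ι) :=
    hV.iIndepFun_of_covariance_eq_zero fun i j hij => by
      rw [covariance_linear_gaussianPi, hvv, if_neg hij]
  rw [(iIndepFun_iff_map_fun_eq_pi_map (fun i => (hV.eval i).aemeasurable)).1 hiind]
  congr 1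
  funext i
  rw [(hV.eval i).map_eq_gaussianReal, integral_linear_gaussianPi,
    ← covariance_self (hV.eval i).aemeasurable, covariance_linear_gaussianPi, hvv]
  simp

end GaussianPi

/-! ### Product laws -/

/-- If, for every fixed first argument, the second component of `F` has law `ν` and is independent
of the first component, then the same holds under the product measure. -/
theorem map_prod_eq_prod_of_forall {X Y B C : Type*} [MeasurableSpace X] [MeasurableSpace Y]
    [MeasurableSpace B] [MeasurableSpace C] (ρ : Measure X) [IsProbabilityMeasure ρ]
    (γ : Measure Y) [IsProbabilityMeasure γ] (ν : Measure C) [IsProbabilityMeasure ν]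
    (F : X × Y → B × C) (hF : Measurable F)
    (h : ∀ x, γ.map (fun y => F (x, y)) = (γ.map fun y => (F (x, y)).1).prod ν) :
    (ρ.prod γ).map F = ((ρ.prod γ).map fun p => (F p).1).prod ν := by
  have hF1 : Measurable fun p => (F p).1 := hF.fst
  have : IsProbabilityMeasure ((ρ.prod γ).map fun p => (F p).1) :=
    Measure.isProbabilityMeasure_map hF1.aemeasurable
  -- Rectangles suffice: on each slice the factor `ν t` does not depend on `x`, so it comes out of
  -- the integral over `x`.
  refine (Measure.prod_eq fun s t hs ht => ?_).symm
  rw [Measure.map_apply hF (hs.prod ht), Measure.prod_apply (hF (hs.prod ht)),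
    Measure.map_apply hF1 hs, Measure.prod_apply (hF1 hs), ← lintegral_mul_const'' _
      (measurable_measure_prodMk_left (hF1 hs)).aemeasurable]
  refine lintegral_congr fun x => ?_
  have hFx : Measurable fun y => F (x, y) := hF.comp measurable_prodMk_left
  have : IsProbabilityMeasure (γ.map fun y => (F (x, y)).1) :=
    Measure.isProbabilityMeasure_map hFx.fst.aemeasurable
  have hx := congrArg (fun m => m (s ×ˢ t)) (h x)
  simp only [Measure.prod_prod] at hx
  rw [Measure.map_apply hFx (hs.prod ht), Measure.map_apply hFx.fst hs] at hx
  exact hx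

/-! ### Posterior updates -/

instance Stats.instMeasurableSpace (A : Type*) : MeasurableSpace (Stats A) :=
  MeasurableSpace.comap (fun s => (s.count, s.total)) inferInstance

namespace Stats

variable {A κ : Type*} [Fintype κ]

lemma measurable_count : Measurable (Stats.count : Stats A → A → ℕ) :=
  measurable_fst.comp (comap_measurable fun s : Stats A => (s.count, s.total))

lemma measurable_total : Measurable (Stats.total : Stats A → A → ℝ) :=
  measurable_snd.comp (comap_measurable fun s : Stats A => (s.count, s.total))

lemma measurable_of_components {X : Type*} {m : MeasurableSpace X} {f : X → Stats A}
    (hc : ∀ i, Measurable fun x => (f x).count i) (ht : ∀ i, Measurable fun x => (f x).total i) :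
    Measurable f :=
  measurable_comap_iff.2 ((measurable_pi_iff.2 hc).prodMk (measurable_pi_iff.2 ht))

/-- The number of agents whose super-arm contains `i`. -/
def plays (a : κ → Finset A) (i : A) : ℕ := (Finset.univ.filter fun k => i ∈ a k).card

/-- The statistics after observing the rewards `r k` of the base arms in `a k`, for all `k`. -/
def update (s : Stats A) (a : κ → Finset A) (r : κ → A → ℝ) : Stats A :=
  ⟨fun i => s.count i + plays a i, fun i => s.total i + ∑ k, if i ∈ a k then r k i else 0⟩

end Stats

namespace SemiBandit

variable {A κ : Type*} [Fintype κ] (M : SemiBandit A)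

/-- The parameters at standardized position `z` with respect to the posterior. -/
def posterior (s : Stats A) (z : A → ℝ) (i : A) : ℝ :=
  M.postMean s i + √(M.postVar s i) * z i

/-- The standardized position of the parameters `θ` with respect to the posterior. -/
def zscore (s : Stats A) (θ : A → ℝ) (i : A) : ℝ :=
  (θ i - M.postMean s i) / √(M.postVar s i)

lemma measurable_postVar (i : A) : Measurable fun s => M.postVar s i := by
  have : Measurable fun s : Stats A => ((s.count i : ℕ) : ℝ) :=
    measurable_from_top.comp ((measurable_pi_apply i).comp Stats.measurable_count)
  unfold postVar
  fun_prop

lemma measurable_postMean (i : A) : Measurable fun s => M.postMean s i := by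
  have h1 := M.measurable_postVar i
  have h2 : Measurable fun s : Stats A => s.total i :=
    (measurable_pi_apply i).comp Stats.measurable_total
  unfold postMean
  fun_prop

lemma measurable_posterior : Measurable fun p : Stats A × (A → ℝ) => M.posterior p.1 p.2 := by
  refine measurable_pi_iff.2 fun i => ?_
  have h1 : Measurable fun p : Stats A × (A → ℝ) => M.postVar p.1 i :=
    (M.measurable_postVar i).comp measurable_fst
  have h2 : Measurable fun p : Stats A × (A → ℝ) => M.postMean p.1 i :=
    (M.measurable_postMean i).comp measurable_fst
  have h3 : Measurable fun p : Stats A × (A → ℝ) => p.2 i :=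
    (measurable_pi_apply i).comp measurable_snd
  exact h2.add (h1.sqrt.mul h3)

lemma measurable_zscore : Measurable fun p : Stats A × (A → ℝ) => M.zscore p.1 p.2 := by
  refine measurable_pi_iff.2 fun i => ?_
  have h1 : Measurable fun p : Stats A × (A → ℝ) => M.postVar p.1 i :=
    (M.measurable_postVar i).comp measurable_fst
  have h2 : Measurable fun p : Stats A × (A → ℝ) => M.postMean p.1 i :=
    (M.measurable_postMean i).comp measurable_fst
  have h3 : Measurable fun p : Stats A × (A → ℝ) => p.2 i :=
    (measurable_pi_apply i).comp measurable_snd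
  exact (h3.sub h2).div h1.sqrt

variable {M}

lemma postVar_pos (hp : ∀ i, 0 < M.priorSD i) (s : Stats A) (i : A) : 0 < M.postVar s i := by
  have := hp i
  unfold postVar
  positivity

/-- This allows the parameters to be replaced by their standardized position, and recovered from it,
at any statistics. -/
lemma posterior_zscore (hp : ∀ i, 0 < M.priorSD i) (s : Stats A) (θ : A → ℝ) :
    M.posterior s (M.zscore s θ) = θ := by
  funext i
  have := Real.sqrt_pos.2 (postVar_pos hp s i)
  simp only [posterior, zscore]
  field_simp
  ring

/-! ### Conjugacy -/

section Coeff

variable [Fintype A] (a : κ → Finset A) (α β : A → ℝ)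

/-- Coefficients of the linear form that combines the `i`-th coordinate of a vector indexed by `A`
with the `i`-th coordinates of the vectors of the agents whose super-arm contains `i`. -/
def coeff (i : A) : A ⊕ κ × A → ℝ :=
  Sum.elim (fun j => if j = i then α i else 0)
    (fun p => if p.2 = i then (if i ∈ a p.1 then β i else 0) else 0)

lemma sum_coeff_mul (i : A) (x : A ⊕ κ × A → ℝ) :
    ∑ l, coeff a α β i l * x l =
      α i * x (.inl i) + β i * ∑ k, if i ∈ a k then x (.inr (k, i)) else 0 := by
  simp [coeff, Fintype.sum_sum_type, Fintype.sum_prod_type, Finset.mul_sum]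

/-- Forms attached to different base arms have disjoint supports. Orthogonality thus reduces to one
scalar identity per base arm. -/
lemma sum_coeff_mul_coeff (α' β' : A → ℝ) (i j : A) :
    ∑ l, coeff a α β i l * coeff a α' β' j l =
      if i = j then α i * α' i + Stats.plays a i * (β i * β' i) else 0 := by
  rw [sum_coeff_mul]
  split_ifs with h
  · subst h
    simp only [coeff, Sum.elim_inl, Sum.elim_inr, if_true, Stats.plays]
    congr 1
    rw [Finset.card_filter, Finset.mul_sum, Nat.cast_sum, Finset.sum_mul]
    refine Finset.sum_congr rfl fun k _ => ?_
    split_ifs <;> simp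
  · simp [coeff, h]

end Coeff

/-- Precisions add up, one noise precision per play. -/
lemma inv_postVar_update (s : Stats A) (a : κ → Finset A)
    (r : κ → A → ℝ) (i : A) :
    (M.postVar (s.update a r) i)⁻¹ =
      (M.postVar s i)⁻¹ + Stats.plays a i / M.noiseSD i ^ 2 := by
  simp only [postVar, Stats.update, inv_inv]
  push_cast
  ring

lemma postMean_update (hp : ∀ i, 0 < M.priorSD i) (s : Stats A) (a : κ → Finset A)
    (r : κ → A → ℝ) (i : A) :
    M.postMean (s.update a r) i = M.postVar (s.update a r) i *
      ((M.postVar s i)⁻¹ * M.postMean s i +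
        (∑ k, if i ∈ a k then r k i else 0) / M.noiseSD i ^ 2) := by
  have h := (postVar_pos hp s i).ne'
  unfold postMean
  rw [← mul_assoc, inv_mul_cancel₀ h, one_mul]
  simp only [Stats.update]
  ring

lemma sum_ite_add_mul (a : κ → Finset A) (c b : ℝ) (w : κ → ℝ) (i : A) :
    (∑ k, if i ∈ a k then c + b * w k else 0) =
      Stats.plays a i * c + b * ∑ k, if i ∈ a k then w k else 0 := by
  rw [Stats.plays, Finset.card_filter, Nat.cast_sum, Finset.sum_mul, Finset.mul_sum,
    ← Finset.sum_add_distrib]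
  refine Finset.sum_congr rfl fun k _ => ?_
  split_ifs <;> simp

/-- Conjugacy of the Gaussian prior: for fixed super-arms, the standardized position of the
parameters with respect to the updated posterior is a standard Gaussian vector independent of the
updated statistics. -/
theorem map_update_zscore [Fintype A] (hp : ∀ i, 0 < M.priorSD i) (hn : ∀ i, 0 < M.noiseSD i)
    (s : Stats A) (a : κ → Finset A)
    (upd : (A ⊕ κ × A → ℝ) → Stats A)
    (hupd : ∀ x, upd x = s.update a fun k i =>
      M.posterior s (fun j => x (.inl j)) i + M.noiseSD i * x (.inr (k, i))) :
    (gaussianPi (A ⊕ κ × A)).map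
        (fun x => (upd x, M.zscore (upd x) (M.posterior s fun j => x (.inl j)))) =
      ((gaussianPi (A ⊕ κ × A)).map upd).prod (gaussianPi A) := by
  set τ : A → ℝ := fun i => √(M.postVar s i) with hτ
  -- The posterior variance depends on the counts only, so zero rewards serve to define it.
  set τ' : A → ℝ := fun i => √(M.postVar (s.update a fun _ _ => 0) i) with hτ'
  have hτpos (i : A) : 0 < τ i := Real.sqrt_pos.2 (postVar_pos hp s i)
  have hτpos' (i : A) : 0 < τ' i := Real.sqrt_pos.2 (postVar_pos hp _ i)
  have hτsq (i : A) : M.postVar s i = τ i ^ 2 := (Real.sq_sqrt (postVar_pos hp s i).le).symm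
  have hτsq' (r : κ → A → ℝ) (i : A) : M.postVar (s.update a r) i = τ' i ^ 2 :=
    (Real.sq_sqrt (postVar_pos hp (s.update a fun _ _ => 0) i).le).symm
  have hprec (i : A) : (τ' i ^ 2)⁻¹ = (τ i ^ 2)⁻¹ + Stats.plays a i / M.noiseSD i ^ 2 := by
    rw [← hτsq, ← hτsq' (fun _ _ => 0), inv_postVar_update]
  have hprec' (i : A) : M.noiseSD i ^ 2 * τ i ^ 2 =
      τ' i ^ 2 * (M.noiseSD i ^ 2 + Stats.plays a i * τ i ^ 2) := by
    have h := hprec i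
    have h1 := hτpos i; have h2 := hτpos' i; have h3 := hn i
    field_simp at h
    linarith
  -- `u i` is the random part of the total reward observed for `i`, and `v i` will be the new
  -- standardized position. The `x (.inl j)` are the old standardized positions and the `x (.inr (k,
  -- j))` are the reward noises.
  set u : A → A ⊕ κ × A → ℝ := coeff a (fun i => Stats.plays a i * τ i) M.noiseSD with hu
  set v : A → A ⊕ κ × A → ℝ := coeff a (fun i => τ' i / τ i) (fun i => -(τ' i / M.noiseSD i))
    with hv
  set g : (A → ℝ) → Stats A := fun y => ⟨fun i => s.count i + Stats.plays a i,
    fun i => s.total i + (Stats.plays a i * M.postMean s i + y i)⟩ with hg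
  have hgm : Measurable g :=
    Stats.measurable_of_components (fun i => measurable_const) fun i => by
      simp only [hg]; fun_prop
  have hsum (x : A ⊕ κ × A → ℝ) (i : A) : (∑ k, if i ∈ a k then
      M.posterior s (fun j => x (.inl j)) i + M.noiseSD i * x (.inr (k, i)) else 0) =
      Stats.plays a i * M.postMean s i + ∑ l, u i l * x l := by
    rw [sum_ite_add_mul, hu, sum_coeff_mul]
    simp only [posterior, hτ]
    ring
  have hupd' (x) : upd x = g fun i => ∑ l, u i l * x l := by
    rw [hupd]
    simp only [Stats.update, hg, hsum]
  have hz (x) : M.zscore (upd x) (M.posterior s fun j => x (.inl j)) =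
      fun i => ∑ l, v i l * x l := by
    funext i
    have h1 := hτpos i; have h2 := hτpos' i; have h3 := hn i
    rw [hupd, zscore, postMean_update hp, hτsq', Real.sqrt_sq h2.le, hsum, hu, hv, sum_coeff_mul,
      sum_coeff_mul, posterior, hτsq, Real.sqrt_sq h1.le]
    generalize (∑ k, if i ∈ a k then x (.inr (k, i)) else 0) = w
    have h := hprec i
    -- Grouped this way, the coefficient of the parameter itself vanishes because the new precision
    -- is the sum in the bracket. Only the old position and the noise remain.
    have e : M.postMean s i + τ i * x (.inl i) - τ' i ^ 2 * ((τ i ^ 2)⁻¹ * M.postMean s i +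
        (Stats.plays a i * M.postMean s i +
          (Stats.plays a i * τ i * x (.inl i) + M.noiseSD i * w)) / M.noiseSD i ^ 2) =
        (M.postMean s i + τ i * x (.inl i)) *
          (1 - τ' i ^ 2 * ((τ i ^ 2)⁻¹ + Stats.plays a i / M.noiseSD i ^ 2)) +
          τ' i ^ 2 * ((τ i ^ 2)⁻¹ * (τ i * x (.inl i)) - M.noiseSD i * w / M.noiseSD i ^ 2) := by
      ring
    rw [e, ← h]
    field_simp
    ring
  -- For a common arm, the prior and noise contributions to `u · v` cancel, while `v · v = 1` is the
  -- precision identity `hprec'`.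
  have key := map_linear_gaussianPi_eq_prod u v
    (fun i j => by
      rw [hu, hv, sum_coeff_mul_coeff]
      split_ifs with h
      · have h1 := hτpos i; have h3 := hn i
        field_simp
        ring
      · rfl)
    (fun i j => by
      rw [hv, sum_coeff_mul_coeff]
      split_ifs with h
      · have h1 := hτpos i; have h2 := hτpos' i; have h3 := hn i
        have h := hprec' i
        field_simp
        linarith
      · rfl)
  have hum : Measurable fun (x : A ⊕ κ × A → ℝ) i => ∑ l, u i l * x l := by fun_prop
  have hvm : Measurable fun (x : A ⊕ κ × A → ℝ) i => ∑ l, v i l * x l := by fun_prop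
  simp only [hz]
  rw [show upd = g ∘ fun (x : A ⊕ κ × A → ℝ) i => ∑ l, u i l * x l from funext hupd',
    ← Measure.map_map hgm hum]
  have : IsProbabilityMeasure
      ((gaussianPi (A ⊕ κ × A)).map fun (x : A ⊕ κ × A → ℝ) i => ∑ l, u i l * x l) :=
    Measure.isProbabilityMeasure_map hum.aemeasurable
  have hprod := Measure.map_prod_map
    ((gaussianPi (A ⊕ κ × A)).map fun (x : A ⊕ κ × A → ℝ) i => ∑ l, u i l * x l)
    (gaussianPi A) hgm measurable_id
  rw [Measure.map_id] at hprod
  rw [hprod, ← key, Measure.map_map (hgm.prodMap measurable_id) (hum.prodMk hvm)]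
  rfl

end SemiBandit

/-- Regrouping of independent components. -/
lemma map_regroup_eq_prod {Ω X Y J I : Type*} [MeasurableSpace Ω] [MeasurableSpace X]
    [MeasurableSpace Y] [Fintype J] [Fintype I] {P : Measure Ω} [IsProbabilityMeasure P]
    {S : Ω → X} {U : Ω → Y} {Z : Ω → J → ℝ} {W : Ω → I → ℝ}
    (hS : Measurable S) (hU : Measurable U) (hZ : Measurable Z) (hW : Measurable W)
    (hSZ : P.map (fun ω => (S ω, Z ω)) = (P.map S).prod (gaussianPi J))
    (hSZU : IndepFun (fun ω => (S ω, Z ω)) U P)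
    (hSZUW : IndepFun (fun ω => ((S ω, Z ω), U ω)) W P) (hWlaw : P.map W = gaussianPi I) :
    P.map (fun ω => ((S ω, U ω), (Sum.elim (Z ω) (W ω) : J ⊕ I → ℝ))) =
      ((P.map S).prod (P.map U)).prod (gaussianPi (J ⊕ I)) := by
  have hPS : IsProbabilityMeasure (P.map S) := Measure.isProbabilityMeasure_map hS.aemeasurable
  have hPU : IsProbabilityMeasure (P.map U) := Measure.isProbabilityMeasure_map hU.aemeasurable
  have h1 : P.map (fun ω => (((S ω, Z ω), U ω), W ω)) =
      (((P.map S).prod (gaussianPi J)).prod (P.map U)).prod (gaussianPi I) := by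
    rw [(indepFun_iff_map_prod_eq_prod_map_map ((hS.prodMk hZ).prodMk hU).aemeasurable
      hW.aemeasurable).1 hSZUW, hWlaw,
      (indepFun_iff_map_prod_eq_prod_map_map (hS.prodMk hZ).aemeasurable hU.aemeasurable).1 hSZU,
      hSZ]
  -- The measure-preserving maps `e1` to `e6` rearrange `((S, Z), U), W` into `(S, U), (Z, W)`, so
  -- that the two Gaussian blocks form one vector.
  have e1 := measurePreserving_prodAssoc (P.map S) (gaussianPi J) (P.map U)
  have e2 : MeasurePreserving (Prod.map id Prod.swap)
      ((P.map S).prod ((gaussianPi J).prod (P.map U)))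
      ((P.map S).prod ((P.map U).prod (gaussianPi J))) :=
    (MeasurePreserving.id (P.map S)).prod Measure.measurePreserving_swap
  have e3 := (measurePreserving_prodAssoc (P.map S) (P.map U) (gaussianPi J)).symm
  have e4 := (e3.comp (e2.comp e1)).prod (MeasurePreserving.id (gaussianPi I))
  have e5 := measurePreserving_prodAssoc ((P.map S).prod (P.map U)) (gaussianPi J) (gaussianPi I)
  have e6 := (MeasurePreserving.id ((P.map S).prod (P.map U))).prod
    (measurePreserving_sumPiEquivProdPi_symm fun _ : J ⊕ I => gaussianReal 0 1)
  have e := e6.comp (e5.comp e4)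
  rw [← e.map_eq, ← h1, Measure.map_map e.measurable (((hS.prodMk hZ).prodMk hU).prodMk hW)]
  congr 1

lemma Stats.measurable_update {A κ X : Type*} [Fintype κ] {m : MeasurableSpace X}
    {s : X → Stats A} {a : X → κ → Finset A} {r : X → κ → A → ℝ} (hs : Measurable s)
    (ha : ∀ k i, MeasurableSet {x | i ∈ a x k}) (hr : ∀ k i, Measurable fun x => r x k i) :
    Measurable fun x => (s x).update (a x) (r x) := by
  refine Stats.measurable_of_components (fun i => ?_) fun i => ?_
  · simp only [Stats.update, Stats.plays, Finset.card_filter]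
    exact ((measurable_pi_apply i).comp (Stats.measurable_count.comp hs)).add
      (Finset.measurable_sum _ fun k _ => Measurable.ite (ha k i) measurable_const measurable_const)
  · simp only [Stats.update]
    exact ((measurable_pi_apply i).comp (Stats.measurable_total.comp hs)).add
      (Finset.measurable_sum _ fun k _ => Measurable.ite (ha k i) (hr k i) measurable_const)

namespace SemiBandit

variable {A : Type*} {M : SemiBandit A}

lemma measurable_posterior_comp {X : Type*} {m : MeasurableSpace X} {f : X → Stats A}
    {g : X → A → ℝ} (hf : Measurable f) (hg : Measurable g) :
    Measurable fun x => M.posterior (f x) (g x) := by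
  have h := M.measurable_posterior.comp (hf.prodMk hg)
  exact h

lemma measurable_zscore_comp {X : Type*} {m : MeasurableSpace X} {f : X → Stats A}
    {g : X → A → ℝ} (hf : Measurable f) (hg : Measurable g) :
    Measurable fun x => M.zscore (f x) (g x) := by
  have h := M.measurable_zscore.comp (hf.prodMk hg)
  exact h

variable [Fintype A]

/-- One round of adaptive observations preserves the independence of the statistics and the
standardized position of the parameters with respect to the posterior. -/
theorem map_update_zscore_of_indep {κ Ω Y : Type*} [Fintype κ] [MeasurableSpace Ω]
    [MeasurableSpace Y] {P : Measure Ω} [IsProbabilityMeasure P]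
    (hp : ∀ i, 0 < M.priorSD i) (hn : ∀ i, 0 < M.noiseSD i)
    {S : Ω → Stats A} {U : Ω → Y} {θ : Ω → A → ℝ} {W : Ω → κ × A → ℝ}
    (hS : Measurable S) (hU : Measurable U) (hθ : Measurable θ) (hW : Measurable W)
    (hSZ : P.map (fun ω => (S ω, M.zscore (S ω) (θ ω))) = (P.map S).prod (gaussianPi A))
    (hSZU : IndepFun (fun ω => (S ω, θ ω)) U P)
    (hSZUW : IndepFun (fun ω => ((S ω, θ ω), U ω)) W P)
    (hWlaw : P.map W = gaussianPi (κ × A))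
    (a : Stats A × Y → κ → Finset A) (ha : ∀ k i, MeasurableSet {p | i ∈ a p k})
    (S' : Ω → Stats A) (hS' : ∀ ω, S' ω = (S ω).update (a (S ω, U ω))
      fun k i => θ ω i + M.noiseSD i * W ω (k, i)) :
    P.map (fun ω => (S' ω, M.zscore (S' ω) (θ ω))) = (P.map S').prod (gaussianPi A) := by
  obtain ⟨Z, hZdef⟩ : ∃ Z : Ω → A → ℝ, Z = fun ω => M.zscore (S ω) (θ ω) := ⟨_, rfl⟩
  have hZ : Measurable Z := by
    rw [hZdef]
    exact M.measurable_zscore.comp (hS.prodMk hθ)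
  have hzm : Measurable fun p : Stats A × (A → ℝ) => (p.1, M.zscore p.1 p.2) :=
    measurable_fst.prodMk M.measurable_zscore
  have hθZ (ω) : M.posterior (S ω) (Z ω) = θ ω := by rw [hZdef, posterior_zscore hp]
  have hSZU' : IndepFun (fun ω => (S ω, Z ω)) U P := by
    rw [hZdef]
    exact hSZU.comp (φ := fun p => (p.1, M.zscore p.1 p.2)) hzm measurable_id
  have hSZUW' : IndepFun (fun ω => ((S ω, Z ω), U ω)) W P := by
    rw [hZdef]
    exact hSZUW.comp (φ := fun q => ((q.1.1, M.zscore q.1.1 q.1.2), q.2))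
      ((hzm.comp measurable_fst).prodMk measurable_snd) measurable_id
  have hlaw := map_regroup_eq_prod hS hU hZ hW (by rw [hZdef]; exact hSZ) hSZU' hSZUW' hWlaw
  obtain ⟨upd, hupd⟩ : ∃ upd : (Stats A × Y) × (A ⊕ κ × A → ℝ) → Stats A, upd = fun p =>
    p.1.1.update (a p.1) fun k i =>
      M.posterior p.1.1 (fun j => p.2 (.inl j)) i + M.noiseSD i * p.2 (.inr (k, i)) := ⟨_, rfl⟩
  have hpost : Measurable fun p : (Stats A × Y) × (A ⊕ κ × A → ℝ) =>
      M.posterior p.1.1 fun j => p.2 (.inl j) := by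
    have h1 : Measurable fun p : (Stats A × Y) × (A ⊕ κ × A → ℝ) => p.1.1 :=
      measurable_fst.comp measurable_fst
    have h2 : Measurable fun (p : (Stats A × Y) × (A ⊕ κ × A → ℝ)) (j : A) => p.2 (.inl j) :=
      measurable_pi_iff.2 fun j => (measurable_pi_apply _).comp measurable_snd
    exact measurable_posterior_comp h1 h2
  have hupdm : Measurable upd := by
    rw [hupd]
    exact Stats.measurable_update (measurable_fst.comp measurable_fst)
      (fun k i => measurable_fst (ha k i)) fun k i =>
      ((measurable_pi_apply i).comp hpost).add
        (((measurable_pi_apply _).comp measurable_snd).const_mul _)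
  have hPS : IsProbabilityMeasure (P.map S) := Measure.isProbabilityMeasure_map hS.aemeasurable
  have hPU : IsProbabilityMeasure (P.map U) := Measure.isProbabilityMeasure_map hU.aemeasurable
  -- Fixing `(S, U)` fixes the super-arms. Adaptivity disappears on each slice, where the conjugacy
  -- of `map_update_zscore` applies.
  have key := map_prod_eq_prod_of_forall ((P.map S).prod (P.map U)) (gaussianPi (A ⊕ κ × A))
    (gaussianPi A)
    (fun p => (upd p, M.zscore (upd p) (M.posterior p.1.1 fun j => p.2 (.inl j))))
    (hupdm.prodMk (measurable_zscore_comp hupdm hpost))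
    fun p => map_update_zscore hp hn p.1 (a p) (fun x => upd (p, x)) fun x => by rw [hupd]
  have hm : Measurable fun ω => ((S ω, U ω), (Sum.elim (Z ω) (W ω) : A ⊕ κ × A → ℝ)) := by
    refine (hS.prodMk hU).prodMk (measurable_pi_iff.2 fun l => ?_)
    cases l with
    | inl j => exact (measurable_pi_apply j).comp hZ
    | inr j => exact (measurable_pi_apply j).comp hW
  have hS'eq (ω) : S' ω = upd ((S ω, U ω), Sum.elim (Z ω) (W ω)) := by
    rw [hS', hupd]
    simp only [Sum.elim_inl, Sum.elim_inr, hθZ]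
  rw [← hlaw, Measure.map_map (hupdm.prodMk (measurable_zscore_comp hupdm hpost)) hm,
    Measure.map_map hupdm hm] at key
  have hc1 : (fun p => (upd p, M.zscore (upd p) (M.posterior p.1.1 fun j => p.2 (.inl j)))) ∘
      (fun ω => ((S ω, U ω), (Sum.elim (Z ω) (W ω) : A ⊕ κ × A → ℝ))) =
      fun ω => (S' ω, M.zscore (S' ω) (θ ω)) := by
    funext ω
    simp only [Function.comp_apply, ← hS'eq, Sum.elim_inl, hθZ]
  have hc2 : (fun p => upd p) ∘
      (fun ω => ((S ω, U ω), (Sum.elim (Z ω) (W ω) : A ⊕ κ × A → ℝ))) = S' :=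
    funext fun ω => (hS'eq ω).symm
  rw [hc1, hc2] at key
  exact key

end SemiBandit

/-! ### Information available before a step -/

section Information

variable {A : Type*} {K : ℕ}

/-- The information carried by a set of sources of randomness. -/
abbrev info (S : Set (Noise A K)) : MeasurableSpace (Outcome A K) :=
  ⨆ n ∈ S, MeasurableSpace.comap (fun ω => ω n) inferInstance

lemma measurable_info {S : Set (Noise A K)} {n : Noise A K} (hn : n ∈ S) :
    Measurable[info S] fun ω : Outcome A K => ω n :=
  Measurable.of_comap_le (le_iSup₂_of_le n hn le_rfl)

lemma measurable_info_pi {ι β : Type*} [MeasurableSpace β] {S : Set (Noise A K)}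
    {f : Outcome A K → ι → β} (h : ∀ i, Measurable[info S] fun ω => f ω i) :
    Measurable[info S] f :=
  (@measurable_pi_iff _ _ _ (info S) _ _).2 h

/-- Disjoint sets of independent coordinates generate independent σ-algebras. Independence claims
about the algorithm thus become a matter of which sources each quantity uses. -/
lemma indepFun_of_info {X Y : Type*} [MeasurableSpace X] [MeasurableSpace Y]
    {S T : Set (Noise A K)} (hST : Disjoint S T) {f : Outcome A K → X} {g : Outcome A K → Y}
    (hf : Measurable[info S] f) (hg : Measurable[info T] g) : IndepFun f g (law A K) := by
  have h : iIndepFun (fun (n : Noise A K) (ω : Outcome A K) => ω n) (law A K) :=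
    iIndepFun_infinitePi (X := fun _ : Noise A K => id) fun _ => measurable_id
  exact indep_of_indep_of_le
    (indep_iSup_of_disjoint (fun n => (measurable_pi_apply n).comap_le) h.iIndep hST)
    hf.comap_le hg.comap_le

instance : IsProbabilityMeasure (law A K) := by unfold law; infer_instance

lemma map_law_of_injective {ι : Type*} [Fintype ι] {f : ι → Noise A K}
    (hf : Function.Injective f) : (law A K).map (fun ω i => ω (f i)) = gaussianPi ι := by
  rw [law, Measure.map_infinitePi_infinitePi_of_inj hf, Measure.infinitePi_eq_pi]

/-- The sources of randomness that have been used before step `t`. -/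
def past (A : Type*) (K t : ℕ) : Set (Noise A K)
  | .prior _ => True
  | .init _ => True
  | .obs t' _ _ => t' < t
  | .post t' _ _ => t' < t

lemma past_mono {t t' : ℕ} (h : t ≤ t') : past A K t ⊆ past A K t' := by
  rintro (i | i | ⟨r, k, i⟩ | ⟨r, k, i⟩) hn
  · trivial
  · trivial
  · exact lt_of_lt_of_le hn h
  · exact lt_of_lt_of_le hn h

end Information

/-! ### The posterior property along the run of the algorithm -/

namespace SemiBandit

variable {A : Type*} {K : ℕ} {M : SemiBandit A} {oracle : (A → ℝ) → Finset A}

lemma stats_succ (ω : Outcome A K) (t : ℕ) :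
    M.stats oracle ω (t + 1) = (M.stats oracle ω t).update
      (fun k => oracle (M.posterior (M.stats oracle ω t) fun i => ω (.post t k i)))
      fun k i => M.trueParam ω i + M.noiseSD i * ω (.obs t k i) := rfl

lemma measurable_trueParam {m : MeasurableSpace (Outcome A K)}
    (h : ∀ i, Measurable fun ω : Outcome A K => ω (.prior i)) :
    Measurable fun ω : Outcome A K => M.trueParam ω :=
  measurable_pi_iff.2 fun i => ((h i).const_mul _).const_add _

variable [Fintype A]

lemma IsOracle.measurableSet_mem (ho : M.IsOracle oracle) (i : A) :
    MeasurableSet {θ | i ∈ oracle θ} := by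
  have : {θ | i ∈ oracle θ} = ⋃ a ∈ Finset.univ.filter fun a : Finset A => i ∈ a,
      oracle ⁻¹' {a} := by
    ext θ; simp
  rw [this]
  exact Finset.measurableSet_biUnion _ fun a _ => ho.measurable a

/-- The initial plays are one round of a single agent that plays every base arm, starting from empty
statistics. The base case of `map_stats_zscore` is thereby covered by the same one-round theorem as
its induction step. -/
lemma stats_zero (ω : Outcome A K) :
    M.stats oracle ω 0 = Stats.update ⟨fun _ => 0, fun _ => 0⟩ (fun _ : Unit => Finset.univ)
      fun _ i => M.trueParam ω i + M.noiseSD i * ω (.init i) := by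
  simp only [stats, Stats.update, Stats.plays]
  congr 1
  · funext i; simp
  · funext i; simp [initReward]

/-- The σ-algebra `m` is left free: the product σ-algebra gives plain measurability, while `info
(past A K t)` says that the statistics use past sources only, whence their independence from the
randomness of step `t`. -/
lemma measurable_stats_of (ho : M.IsOracle oracle) {m : MeasurableSpace (Outcome A K)} (t : ℕ)
    (h : ∀ n ∈ past A K t, Measurable fun ω : Outcome A K => ω n) :
    Measurable fun ω : Outcome A K => M.stats oracle ω t := by
  have hθ (i : A) : Measurable fun ω : Outcome A K => M.trueParam ω i :=
    ((h (.prior i) trivial).const_mul _).const_add _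
  induction t with
  | zero =>
    simp only [stats_zero]
    exact Stats.measurable_update measurable_const (fun _ _ => MeasurableSet.const _)
      fun _ i => (hθ i).add ((h (.init i) trivial).const_mul _)
  | succ t ih =>
    simp only [stats_succ]
    have hs := ih fun n hn => h n (past_mono t.le_succ hn)
    refine Stats.measurable_update hs (fun k i => ?_) fun k i =>
      (hθ i).add ((h (.obs t k i) (Nat.lt_succ_self t)).const_mul _)
    exact (M.measurable_posterior.comp (hs.prodMk (measurable_pi_iff.2 fun j =>
      h (.post t k j) (Nat.lt_succ_self t)))) (ho.measurableSet_mem i)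

lemma measurable_stats (ho : M.IsOracle oracle) (t : ℕ) :
    Measurable fun ω : Outcome A K => M.stats oracle ω t :=
  measurable_stats_of ho t fun n _ => measurable_pi_apply n

/-- The standardized position of the true parameters with respect to the posterior is a standard
Gaussian vector independent of the statistics. -/
theorem map_stats_zscore (ho : M.IsOracle oracle) (hp : ∀ i, 0 < M.priorSD i)
    (hn : ∀ i, 0 < M.noiseSD i) (t : ℕ) :
    (law A K).map (fun ω => (M.stats oracle ω t, M.zscore (M.stats oracle ω t) (M.trueParam ω))) =
      ((law A K).map fun ω => M.stats oracle ω t).prod (gaussianPi A) := by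
  have hθ : Measurable fun ω : Outcome A K => M.trueParam ω :=
    measurable_trueParam fun i => measurable_pi_apply _
  induction t with
  | zero =>
    -- Without observations the posterior is the prior, so the standardized position is the prior
    -- noise itself.
    have hz (ω : Outcome A K) : M.zscore ⟨fun _ => 0, fun _ => 0⟩ (M.trueParam ω) =
        fun i => ω (.prior i) := by
      funext i
      have := hp i
      simp only [zscore, postMean, postVar, trueParam]
      simp only [Nat.cast_zero, zero_div, add_zero, one_div, inv_inv]
      rw [Real.sqrt_sq this.le]
      field_simp
      ring
    refine map_update_zscore_of_indep (κ := Unit) (Y := Unit) hp hn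
      (S := fun _ => ⟨fun _ => 0, fun _ => 0⟩) (U := fun _ => ()) (θ := fun ω => M.trueParam ω)
      (W := fun ω p => ω (.init p.2)) measurable_const measurable_const hθ
      (measurable_pi_iff.2 fun p => measurable_pi_apply _) ?_ (indepFun_const_right _ _) ?_ ?_
      (fun _ _ => Finset.univ) (fun _ _ => MeasurableSet.const _) _ stats_zero
    · simp only [hz]
      rw [(indepFun_iff_map_prod_eq_prod_map_map measurable_const.aemeasurable
        (measurable_pi_iff.2 fun i => measurable_pi_apply _).aemeasurable).1
        (indepFun_const_left _ _), map_law_of_injective fun i j h => by simpa using h]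
    · refine indepFun_of_info (S := Set.range .prior) (T := Set.range .init) ?_
        ((measurable_const.prodMk (measurable_trueParam (m := info (Set.range .prior))
          fun i => measurable_info ⟨i, rfl⟩)).prodMk
          measurable_const) (measurable_info_pi fun p => measurable_info ⟨p.2, rfl⟩)
      rw [Set.disjoint_left]
      rintro _ ⟨i, rfl⟩ ⟨j, hj⟩
      cases hj
    · exact map_law_of_injective fun i j h => by
        simp only [Noise.init.injEq] at h
        exact Prod.ext rfl h
  | succ t ih =>
    have hs : Measurable[info (past A K t)] fun ω : Outcome A K => M.stats oracle ω t :=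
      measurable_stats_of ho t fun n hn => measurable_info hn
    have hθt : Measurable[info (past A K t)] fun ω : Outcome A K => M.trueParam ω :=
      measurable_trueParam fun i => measurable_info (S := past A K t) (n := .prior i) trivial
    set Q : Set (Noise A K) := Set.range fun p : Fin K × A => .post t p.1 p.2 with hQ
    -- `U` is the randomization that selects the super-arms; `W` is the reward noise, drawn for
    -- every base arm whether or not it is played.
    refine map_update_zscore_of_indep (κ := Fin K) (Y := Fin K → A → ℝ) hp hn
      (S := fun ω => M.stats oracle ω t) (U := fun ω k i => ω (.post t k i))
      (θ := fun ω => M.trueParam ω)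
      (W := fun ω p => ω (.obs t p.1 p.2)) (measurable_stats ho t)
      (measurable_pi_iff.2 fun k => measurable_pi_iff.2 fun i => measurable_pi_apply _) hθ
      (measurable_pi_iff.2 fun p => measurable_pi_apply _) ih ?_ ?_ ?_
      (fun p k => oracle (M.posterior p.1 (p.2 k))) (fun k i => ?_) _ fun ω => stats_succ ω t
    · refine indepFun_of_info (S := past A K t) (T := Q) ?_ (hs.prodMk hθt)
        (measurable_info_pi fun k => measurable_info_pi fun i => measurable_info ⟨(k, i), rfl⟩)
      rw [Set.disjoint_left]
      rintro _ h ⟨p, rfl⟩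
      exact lt_irrefl t h
    · have hle : info (past A K t) ≤ info (past A K t ∪ Q) :=
        iSup₂_le fun n hn => le_iSup₂_of_le n (Or.inl hn) le_rfl
      refine indepFun_of_info (S := past A K t ∪ Q)
        (T := Set.range fun p : Fin K × A => .obs t p.1 p.2) ?_
        (((hs.mono hle le_rfl).prodMk (hθt.mono hle le_rfl)).prodMk
          (measurable_info_pi fun k => measurable_info_pi fun i =>
            measurable_info (Or.inr ⟨(k, i), rfl⟩)))
        (measurable_info_pi fun p => measurable_info ⟨p, rfl⟩)
      rw [Set.disjoint_left]
      rintro _ (h | ⟨q, hq⟩) ⟨p, rfl⟩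
      · exact lt_irrefl t h
      · cases hq
    · exact map_law_of_injective fun p q h => by
        simp only [Noise.obs.injEq, true_and] at h
        exact Prod.ext h.1 h.2
    · exact (M.measurable_posterior.comp (measurable_fst.prodMk
        ((measurable_pi_apply k).comp measurable_snd))) (ho.measurableSet_mem i)

/-- The parameters sampled by an agent have the same law as the true parameters. -/
theorem map_sample_eq_map_trueParam (ho : M.IsOracle oracle) (hp : ∀ i, 0 < M.priorSD i)
    (hn : ∀ i, 0 < M.noiseSD i) (t : ℕ) (k : Fin K) :
    (law A K).map (fun ω => M.sample ω (M.stats oracle ω t) t k) =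
      (law A K).map fun ω => M.trueParam ω := by
  have hθ : Measurable fun ω : Outcome A K => M.trueParam ω :=
    measurable_trueParam fun i => measurable_pi_apply _
  have hs := measurable_stats (K := K) ho t
  have hu : Measurable fun (ω : Outcome A K) i => ω (.post t k i) :=
    measurable_pi_iff.2 fun i => measurable_pi_apply _
  have hind : IndepFun (fun ω : Outcome A K => M.stats oracle ω t)
      (fun ω i => ω (.post t k i)) (law A K) := by
    refine indepFun_of_info (S := past A K t) (T := Set.range fun i => .post t k i) ?_
      (measurable_stats_of ho t fun n hn => measurable_info hn)
      (measurable_info_pi fun i => measurable_info ⟨i, rfl⟩)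
    rw [Set.disjoint_left]
    rintro _ h ⟨p, rfl⟩
    exact lt_irrefl t h
  have h1 : (law A K).map (fun ω => (M.stats oracle ω t, fun i => ω (.post t k i))) =
      ((law A K).map fun ω => M.stats oracle ω t).prod (gaussianPi A) := by
    rw [(indepFun_iff_map_prod_eq_prod_map_map hs.aemeasurable hu.aemeasurable).1 hind,
      map_law_of_injective fun i j h => by simpa using h]
  -- The sample and `θ*` are the images, under the same map, of the pairs (statistics, fresh noise)
  -- and (statistics, standardized position), which have equal laws.
  have h2 := congrArg (Measure.map fun p => M.posterior p.1 p.2)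
    (h1.trans (map_stats_zscore ho hp hn t).symm)
  have hz : Measurable fun ω : Outcome A K => M.zscore (M.stats oracle ω t) (M.trueParam ω) :=
    M.measurable_zscore.comp (hs.prodMk hθ)
  rw [Measure.map_map M.measurable_posterior (hs.prodMk hu),
    Measure.map_map M.measurable_posterior (hs.prodMk hz)] at h2
  refine Eq.trans h2 ?_
  congr 1
  funext ω
  exact posterior_zscore hp _ _

end SemiBandit

/-! ### Lipschitz continuity of the mean reward -/

lemma integrable_id_gaussianReal (μ : ℝ) (v : NNReal) :
    Integrable (fun x : ℝ => x) (gaussianReal μ v) :=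
  memLp_one_iff_integrable.1 (memLp_id_gaussianReal 1)

/-- In the rectified case, translation puts both expectations under the same centred Gaussian, where
`max 0` is 1-Lipschitz pointwise. -/
lemma RewardModel.abs_meanReward_sub_le (m : RewardModel) (s θ θ' : ℝ) :
    |m.meanReward s θ - m.meanReward s θ'| ≤ |θ - θ'| := by
  cases m with
  | gaussian => exact le_rfl
  | rectified =>
    set v : NNReal := ⟨s ^ 2, sq_nonneg s⟩ with hv
    have hint (c : ℝ) : Integrable (fun x => max 0 (x + -c)) (gaussianReal 0 v) :=
      (integrable_const (0 : ℝ)).sup ((integrable_id_gaussianReal 0 v).add (integrable_const _))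
    have hshift (c : ℝ) : ∫ x, max 0 x ∂(gaussianReal (-c) v) =
        ∫ x, max 0 (x + -c) ∂(gaussianReal 0 v) := by
      have h := gaussianReal_map_add_const (μ := 0) (v := v) (-c)
      rw [zero_add] at h
      rw [← h, integral_map (by fun_prop) (by fun_prop)]
    simp only [RewardModel.meanReward]
    rw [hshift, hshift, neg_sub_neg, ← integral_sub (hint _) (hint _)]
    have hb (x : ℝ) : ‖max 0 (x + -θ') - max 0 (x + -θ)‖ ≤ |θ - θ'| := by
      rw [Real.norm_eq_abs]
      refine (abs_max_sub_max_le_max _ _ _ _).trans ?_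
      rw [sub_self, abs_zero, max_eq_right (abs_nonneg _)]
      exact le_of_eq (congrArg _ (by ring))
    have h := norm_integral_le_of_norm_le_const (μ := gaussianReal 0 v) (.of_forall hb)
    simpa using h

lemma RewardModel.continuous_meanReward (m : RewardModel) (s : ℝ) :
    Continuous (m.meanReward s) :=
  (LipschitzWith.of_dist_le_mul (K := 1) fun x y => by
    simpa [Real.dist_eq] using m.abs_meanReward_sub_le s x y).continuous

/-! ### Scalar estimates -/

/-- A pathwise substitute for a tail bound: the excess of `|z|` over `L` is at most `exp (|z| - L)`.
The width `s` is kept in the main term, to be summed over time, and bounded by `1` in the excess. -/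
lemma mul_le_add_exp_add_exp {s L z : ℝ} (hs : 0 ≤ s) (hs1 : s ≤ 1) :
    s * |z| ≤ L * s + Real.exp (-L) * (Real.exp z + Real.exp (-z)) := by
  have h1 : |z| - L ≤ Real.exp (-L) * (Real.exp z + Real.exp (-z)) := by
    have h2 : Real.exp |z| ≤ Real.exp z + Real.exp (-z) := by
      rcases abs_cases z with ⟨h, _⟩ | ⟨h, _⟩ <;> rw [h]
      · linarith [Real.exp_pos (-z)]
      · linarith [Real.exp_pos z]
    calc |z| - L ≤ Real.exp (|z| - L) := by linarith [Real.add_one_le_exp (|z| - L)]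
      _ = Real.exp (-L) * Real.exp |z| := by rw [← Real.exp_add]; ring_nf
      _ ≤ _ := mul_le_mul_of_nonneg_left h2 (Real.exp_pos _).le
  have h0 : 0 ≤ Real.exp (-L) * (Real.exp z + Real.exp (-z)) := by positivity
  calc s * |z| = L * s + s * (|z| - L) := by ring
    _ ≤ L * s + s * (Real.exp (-L) * (Real.exp z + Real.exp (-z))) := by gcongr
    _ ≤ L * s + 1 * (Real.exp (-L) * (Real.exp z + Real.exp (-z))) := by gcongr
    _ = _ := by ring

/-- Meant for square roots `a`, `b` of the play counts before and after a batch. Writing `1 / a` as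
`(1 / a - 1 / b) + 1 / b` separates the cost of stale counts from the sequential cost, and both
bounds telescope. -/
lemma sub_sq_div_le {a b K : ℝ} (ha : 0 < a) (hab : a ≤ b) (hK : b ^ 2 - a ^ 2 ≤ K) :
    (b ^ 2 - a ^ 2) / a ≤ K * (1 / a - 1 / b) + 2 * (b - a) := by
  have hb : 0 < b := ha.trans_le hab
  have h1 : 0 ≤ 1 / a - 1 / b := sub_nonneg.2 (one_div_le_one_div_of_le ha hab)
  have h2 : (b ^ 2 - a ^ 2) / b ≤ 2 * (b - a) := by
    rw [div_le_iff₀ hb]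
    nlinarith [mul_nonneg (sub_nonneg.2 hab) (sub_nonneg.2 hab)]
  calc (b ^ 2 - a ^ 2) / a = (b ^ 2 - a ^ 2) * (1 / a - 1 / b) + (b ^ 2 - a ^ 2) / b := by ring
    _ ≤ K * (1 / a - 1 / b) + 2 * (b - a) := add_le_add (mul_le_mul_of_nonneg_right hK h1) h2

/-- Pulls of an arm, weighted by the inverse square root of the number of previous pulls, when at
most `K` pulls are made simultaneously. -/
lemma sum_div_sqrt_le (N n : ℕ → ℕ) (K T : ℕ) (h0 : N 0 = 1) (hN : ∀ t, N (t + 1) = N t + n t)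
    (hn : ∀ t, n t ≤ K) :
    ∑ t ∈ Finset.range T, (n t : ℝ) / √(N t) ≤ K + 2 * √((T : ℝ) * K) := by
  have hpos (t : ℕ) : 1 ≤ N t := by
    induction t with
    | zero => exact h0.ge
    | succ t ih => rw [hN]; omega
  have hle (t : ℕ) : N t ≤ 1 + t * K := by
    induction t with
    | zero => simp [h0]
    | succ t ih => rw [hN]; have := hn t; linarith
  have hsq (t : ℕ) : √(N t : ℝ) ^ 2 = N t := Real.sq_sqrt (Nat.cast_nonneg _)
  have hspos (t : ℕ) : 0 < √(N t : ℝ) := Real.sqrt_pos.2 (by exact_mod_cast hpos t)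
  have hstep (t : ℕ) : (n t : ℝ) / √(N t) ≤
      K * (1 / √(N t) - 1 / √(N (t + 1))) + 2 * (√(N (t + 1)) - √(N t)) := by
    have e : (n t : ℝ) = √(N (t + 1) : ℝ) ^ 2 - √(N t : ℝ) ^ 2 := by
      rw [hsq, hsq, hN]; push_cast; ring
    have hK : √(N (t + 1) : ℝ) ^ 2 - √(N t : ℝ) ^ 2 ≤ K := by
      rw [← e]; exact_mod_cast hn t
    rw [e]
    exact sub_sq_div_le (hspos t) (Real.sqrt_le_sqrt (by rw [hN]; push_cast; simp)) hK
  have htel : ∑ t ∈ Finset.range T, (n t : ℝ) / √(N t) ≤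
      K * (1 / √(N 0) - 1 / √(N T)) + 2 * (√(N T) - √(N 0)) := by
    refine (Finset.sum_le_sum fun t _ => hstep t).trans (le_of_eq ?_)
    rw [Finset.sum_add_distrib, ← Finset.mul_sum, ← Finset.mul_sum,
      Finset.sum_range_sub' (fun t => 1 / √(N t : ℝ)), Finset.sum_range_sub fun t => √(N t : ℝ)]
  -- The `1` here is cancelled by `√(N 0) = 1` in the telescoped sum.
  have hT : √(N T : ℝ) ≤ 1 + √((T : ℝ) * K) := by
    have h1 : (N T : ℝ) ≤ 1 + T * K := by exact_mod_cast hle T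
    rw [Real.sqrt_le_left (by positivity)]
    nlinarith [Real.sq_sqrt (show (0 : ℝ) ≤ T * K by positivity), Real.sqrt_nonneg ((T : ℝ) * K)]
  rw [h0, Nat.cast_one, Real.sqrt_one] at htel
  have h2 : (0 : ℝ) ≤ K * (1 / √(N T)) := by positivity
  linarith

/-- The total excess at truncation level `log (T * K)`. If `T * K = 0` the exponential is `1`
because `log 0 = 0`, but the prefactor vanishes; otherwise the product is `1 ≤ K`. -/
lemma mul_exp_neg_log_le (T K : ℕ) : (T : ℝ) * K * Real.exp (-Real.log ((T : ℝ) * K)) ≤ K := by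
  rcases Nat.eq_zero_or_pos (T * K) with h | h
  · have h' : (T : ℝ) * K = 0 := by exact_mod_cast h
    rw [h', zero_mul]
    exact Nat.cast_nonneg K
  · have h' : (0 : ℝ) < (T : ℝ) * K := by exact_mod_cast h
    rw [Real.exp_neg, Real.exp_log h', mul_inv_cancel₀ h'.ne']
    exact_mod_cast Nat.pos_of_mul_pos_left h

lemma integrable_exp_add_exp_neg {Ω : Type*} [MeasurableSpace Ω] {P : Measure Ω} {X : Ω → ℝ}
    (hX : HasLaw X (gaussianReal 0 1) P) :
    Integrable (fun ω => Real.exp (X ω) + Real.exp (-X ω)) P := by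
  have h1 := integrable_exp_mul_gaussianReal (μ := 0) (v := 1) 1
  have h2 := integrable_exp_mul_gaussianReal (μ := 0) (v := 1) (-1)
  simp only [one_mul, neg_one_mul] at h1 h2
  have h := h1.add h2
  rw [← hX.map_eq, integrable_map_measure (by fun_prop) hX.aemeasurable] at h
  exact h

lemma integral_exp_add_exp_neg {Ω : Type*} [MeasurableSpace Ω] {P : Measure Ω} {X : Ω → ℝ}
    (hX : HasLaw X (gaussianReal 0 1) P) :
    ∫ ω, Real.exp (X ω) + Real.exp (-X ω) ∂P ≤ 4 := by
  have h1 := integrable_exp_mul_gaussianReal (μ := 0) (v := 1) 1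
  have h2 := integrable_exp_mul_gaussianReal (μ := 0) (v := 1) (-1)
  have m1 := mgf_gaussianReal (X := id) (p := gaussianReal 0 1) (μ := 0) (v := 1) Measure.map_id 1
  have m2 := mgf_gaussianReal (X := id) (p := gaussianReal 0 1) (μ := 0) (v := 1)
    Measure.map_id (-1)
  simp only [mgf, id, one_mul, neg_one_mul] at h1 h2 m1 m2
  have h := hX.integral_comp (f := fun x => Real.exp x + Real.exp (-x)) (by fun_prop)
  simp only [Function.comp_def] at h
  rw [h, integral_add h1 h2, m1, m2]
  norm_num
  -- Both moments equal `exp (1 / 2)`, so the claim is `2 * √e ≤ 4`.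
  have h3 : Real.exp (1 / 2) ^ 2 = Real.exp 1 := by rw [← Real.exp_nat_mul]; norm_num
  nlinarith [Real.exp_one_lt_d9, Real.exp_pos (1 / 2)]

namespace SemiBandit

variable {A : Type*} {K : ℕ} {M : SemiBandit A} {oracle : (A → ℝ) → Finset A}

/-! ### Width of the posterior -/

lemma abs_expReward_sub_le (θ θ' : A → ℝ) (a : Finset A) :
    |M.expReward θ a - M.expReward θ' a| ≤ ∑ i ∈ a, |θ i - θ' i| := by
  rw [expReward, expReward, ← Finset.sum_sub_distrib]
  exact (Finset.abs_sum_le_sum_abs _ _).trans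
    (Finset.sum_le_sum fun i _ => M.model.abs_meanReward_sub_le _ _ _)

/-- Each play adds at least `1` to the precision because the noise is at most `1`. Dropping the
prior precision makes the bound uniform in the prior. -/
lemma sqrt_postVar_le {i : A} (hn : 0 < M.noiseSD i) (hn1 : M.noiseSD i ≤ 1) (s : Stats A)
    (hs : 1 ≤ s.count i) : √(M.postVar s i) ≤ 1 / √(s.count i) := by
  rw [one_div, ← Real.sqrt_inv]
  refine Real.sqrt_le_sqrt (inv_anti₀ (by exact_mod_cast hs) ?_)
  have h1 : (s.count i : ℝ) ≤ s.count i / M.noiseSD i ^ 2 := by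
    rw [le_div_iff₀ (by positivity)]
    exact mul_le_of_le_one_right (Nat.cast_nonneg _) (pow_le_one₀ hn.le hn1)
  have h2 : 0 ≤ 1 / M.priorSD i ^ 2 := by positivity
  linarith

lemma one_le_count (ω : Outcome A K) (t : ℕ) (i : A) : 1 ≤ (M.stats oracle ω t).count i := by
  induction t with
  | zero => exact le_rfl
  | succ t ih => exact ih.trans (Nat.le_add_right _ _)

lemma sqrt_postVar_stats_le_one {i : A} (hn : 0 < M.noiseSD i) (hn1 : M.noiseSD i ≤ 1)
    (ω : Outcome A K) (t : ℕ) : √(M.postVar (M.stats oracle ω t) i) ≤ 1 := by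
  refine (sqrt_postVar_le hn hn1 _ (one_le_count ω t i)).trans ?_
  rw [div_le_one (Real.sqrt_pos.2 (by exact_mod_cast one_le_count ω t i)), Real.one_le_sqrt]
  exact_mod_cast one_le_count ω t i

/-- The total posterior width of a base arm over all its plays. -/
lemma sum_sqrt_postVar_le {i : A} (hn : 0 < M.noiseSD i) (hn1 : M.noiseSD i ≤ 1)
    (ω : Outcome A K) (T : ℕ) :
    ∑ t ∈ Finset.range T, ∑ k, (if i ∈ M.action oracle t k ω then
      √(M.postVar (M.stats oracle ω t) i) else 0) ≤ K + 2 * √((T : ℝ) * K) := by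
  have hplays (t : ℕ) : Stats.plays (fun k : Fin K => M.action oracle t k ω) i ≤ K :=
    (Finset.card_le_univ _).trans (by simp)
  refine le_trans (Finset.sum_le_sum fun t _ => ?_)
    (sum_div_sqrt_le (fun t => (M.stats oracle ω t).count i)
      (fun t => Stats.plays (fun k : Fin K => M.action oracle t k ω) i) K T rfl (fun t => rfl)
      hplays)
  rw [← Finset.sum_filter, Finset.sum_const, nsmul_eq_mul, div_eq_mul_one_div]
  exact mul_le_mul_of_nonneg_left (sqrt_postVar_le hn hn1 _ (one_le_count ω t i))
    (Nat.cast_nonneg _)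

/-- The posterior mean cancels, leaving the posterior standard deviation times a difference of two
standardized positions, each truncated at `L`. The initial play keeps that deviation at most `1`. -/
lemma abs_sample_sub_trueParam_le (hp : ∀ i, 0 < M.priorSD i)
    (hn : ∀ i, 0 < M.noiseSD i ∧ M.noiseSD i ≤ 1) (ω : Outcome A K) (t : ℕ) (k : Fin K) (i : A)
    (L : ℝ) :
    |M.sample ω (M.stats oracle ω t) t k i - M.trueParam ω i| ≤
      2 * L * √(M.postVar (M.stats oracle ω t) i) + Real.exp (-L) *
        ((Real.exp (ω (.post t k i)) + Real.exp (-ω (.post t k i))) +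
        (Real.exp (M.zscore (M.stats oracle ω t) (M.trueParam ω) i) +
          Real.exp (-M.zscore (M.stats oracle ω t) (M.trueParam ω) i))) := by
  set s := M.stats oracle ω t
  have h := congrFun (posterior_zscore hp s (M.trueParam ω)) i
  rw [posterior] at h
  have h0 := Real.sqrt_nonneg (M.postVar s i)
  have h1 : √(M.postVar s i) ≤ 1 := sqrt_postVar_stats_le_one (hn i).1 (hn i).2 ω t
  have b1 := mul_le_add_exp_add_exp (L := L) (z := ω (.post t k i)) h0 h1
  have b2 := mul_le_add_exp_add_exp (L := L) (z := M.zscore s (M.trueParam ω) i) h0 h1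
  have e : M.sample ω s t k i - M.trueParam ω i = √(M.postVar s i) * ω (.post t k i) -
      √(M.postVar s i) * M.zscore s (M.trueParam ω) i := by
    rw [← h, sample]; ring
  rw [e]
  refine (abs_sub _ _).trans ?_
  rw [abs_mul, abs_mul, abs_of_nonneg h0]
  linarith

/-! ### Integrability -/

lemma integrable_ite {Ω : Type*} [MeasurableSpace Ω] {P : Measure Ω} {f : Ω → ℝ} (p : Ω → Prop)
    [DecidablePred p] (hf : Integrable f P) (hp : MeasurableSet {ω | p ω}) :
    Integrable (fun ω => if p ω then f ω else 0) P := by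
  refine (hf.indicator hp).congr (.of_forall fun ω => ?_)
  by_cases h : p ω <;> simp [h]

lemma integrable_trueParam (i : A) :
    Integrable (fun ω : Outcome A K => M.trueParam ω i) (law A K) := by
  have h : Integrable (fun ω : Outcome A K => ω (.prior i)) (law A K) :=
    (measurePreserving_eval_infinitePi (fun _ : Noise A K => gaussianReal 0 1)
      (.prior i)).integrable_comp_of_integrable (integrable_id_gaussianReal 0 1)
  exact (integrable_const _).add (h.const_mul _)

variable [Fintype A]

lemma expReward_eq_sum_ite (θ : A → ℝ) (a : Finset A) :
    M.expReward θ a = ∑ i, if i ∈ a then M.model.meanReward (M.noiseSD i) (θ i) else 0 := by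
  rw [expReward, ← Finset.sum_filter]
  simp

lemma integrable_meanReward {Ω : Type*} [MeasurableSpace Ω] {P : Measure Ω} [IsFiniteMeasure P]
    {X : Ω → ℝ} (hX : Integrable X P) (m : RewardModel) (s : ℝ) :
    Integrable (fun ω => m.meanReward s (X ω)) P := by
  refine Integrable.mono' ((integrable_const |m.meanReward s 0|).add hX.abs)
    ((m.continuous_meanReward s).comp_aestronglyMeasurable hX.aestronglyMeasurable)
    (.of_forall fun ω => ?_)
  have h1 := m.abs_meanReward_sub_le s (X ω) 0
  have h2 := abs_sub_abs_le_abs_sub (m.meanReward s (X ω)) (m.meanReward s 0)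
  rw [sub_zero] at h1
  simp only [Real.norm_eq_abs, Pi.add_apply]
  linarith

lemma integrable_expReward {Ω : Type*} [MeasurableSpace Ω] {P : Measure Ω} [IsFiniteMeasure P]
    (ho : M.IsOracle oracle) {X Y : Ω → A → ℝ} (hX : ∀ i, Integrable (fun ω => X ω i) P)
    (hY : Measurable Y) : Integrable (fun ω => M.expReward (X ω) (oracle (Y ω))) P := by
  simp only [expReward_eq_sum_ite]
  exact integrable_finsetSum _ fun i _ => integrable_ite
    (fun ω => i ∈ oracle (Y ω)) (integrable_meanReward (hX i) M.model (M.noiseSD i))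
    (hY (ho.measurableSet_mem i))

lemma measurable_sample (ho : M.IsOracle oracle) (t : ℕ) (k : Fin K) :
    Measurable fun ω : Outcome A K => M.sample ω (M.stats oracle ω t) t k := by
  have h := measurable_posterior_comp (M := M) (measurable_stats (K := K) ho t)
    (g := fun ω i => ω (.post t k i)) (measurable_pi_iff.2 fun i => measurable_pi_apply _)
  exact h

/-- Integrability depends on the law alone, so it passes from `θ*` to the sample. -/
lemma integrable_sample (ho : M.IsOracle oracle) (hp : ∀ i, 0 < M.priorSD i)
    (hn : ∀ i, 0 < M.noiseSD i) (t : ℕ) (k : Fin K) (i : A) :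
    Integrable (fun ω : Outcome A K => M.sample ω (M.stats oracle ω t) t k i) (law A K) := by
  have hθ : Measurable fun ω : Outcome A K => M.trueParam ω :=
    measurable_trueParam fun i => measurable_pi_apply _
  have h : Integrable (fun θ : A → ℝ => θ i) ((law A K).map fun ω => M.trueParam ω) :=
    (integrable_map_measure (measurable_pi_apply i).aestronglyMeasurable hθ.aemeasurable).2
      (integrable_trueParam i)
  rw [← map_sample_eq_map_trueParam ho hp hn t k, integrable_map_measure
    (measurable_pi_apply i).aestronglyMeasurable (measurable_sample ho t k).aemeasurable] at h
  exact h

end SemiBandit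

namespace SemiBandit

variable {A : Type*} {K : ℕ} {M : SemiBandit A} {oracle : (A → ℝ) → Finset A}

/-! ### The regret bound -/

lemma hasLaw_post (t : ℕ) (k : Fin K) (i : A) :
    HasLaw (fun ω : Outcome A K => ω (.post t k i)) (gaussianReal 0 1) (law A K) :=
  (measurePreserving_eval_infinitePi (fun _ : Noise A K => gaussianReal 0 1)
    (.post t k i)).hasLaw

variable [Fintype A]

lemma hasLaw_zscore (ho : M.IsOracle oracle) (hp : ∀ i, 0 < M.priorSD i)
    (hn : ∀ i, 0 < M.noiseSD i) (t : ℕ) (i : A) :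
    HasLaw (fun ω : Outcome A K => M.zscore (M.stats oracle ω t) (M.trueParam ω) i)
      (gaussianReal 0 1) (law A K) := by
  have hθ : Measurable fun ω : Outcome A K => M.trueParam ω :=
    measurable_trueParam fun i => measurable_pi_apply _
  have hs := measurable_stats (K := K) ho t
  have hz := measurable_zscore_comp (M := M) hs hθ
  refine ⟨((measurable_pi_apply i).comp hz).aemeasurable, ?_⟩
  have : IsProbabilityMeasure ((law A K).map fun ω => M.stats oracle ω t) :=
    Measure.isProbabilityMeasure_map hs.aemeasurable
  have h := congrArg (Measure.map fun p : Stats A × (A → ℝ) => p.2 i)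
    (map_stats_zscore (K := K) ho hp hn t)
  have hm : Measurable fun p : Stats A × (A → ℝ) => p.2 i :=
    (measurable_pi_apply i).comp measurable_snd
  rw [Measure.map_map hm (hs.prodMk hz)] at h
  refine Eq.trans h ?_
  rw [← map_eval_gaussianPi i]
  have h2 : (gaussianPi A) = (((law A K).map fun ω => M.stats oracle ω t).prod
    (gaussianPi A)).map Prod.snd := (measurePreserving_snd (μ := (law A K).map fun ω =>
      M.stats oracle ω t) (ν := gaussianPi A)).map_eq.symm
  conv_rhs => rw [h2, Measure.map_map (measurable_pi_apply i) measurable_snd]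
  rfl

/-- The expected regret of one agent in one step is at most the expected distance, over the base
arms in its super-arm, of its sample from the true parameters. -/
theorem integrable_and_integral_regret_step_le (ho : M.IsOracle oracle)
    (hp : ∀ i, 0 < M.priorSD i) (hn : ∀ i, 0 < M.noiseSD i) (t : ℕ) (k : Fin K) :
    Integrable (fun ω => M.expReward (M.trueParam ω) (oracle (M.trueParam ω)) -
      M.expReward (M.trueParam ω) (M.action oracle t k ω)) (law A K) ∧
    Integrable (fun ω => ∑ i, if i ∈ M.action oracle t k ω then
      |M.sample ω (M.stats oracle ω t) t k i - M.trueParam ω i| else 0) (law A K) ∧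
    ∫ ω, (M.expReward (M.trueParam ω) (oracle (M.trueParam ω)) -
        M.expReward (M.trueParam ω) (M.action oracle t k ω)) ∂(law A K) ≤
      ∫ ω, (∑ i, if i ∈ M.action oracle t k ω then
        |M.sample ω (M.stats oracle ω t) t k i - M.trueParam ω i| else 0) ∂(law A K) := by
  have hθ : Measurable fun ω : Outcome A K => M.trueParam ω :=
    measurable_trueParam fun i => measurable_pi_apply _
  have hsm := measurable_sample (K := K) ho t k
  have hsi := integrable_sample (K := K) ho hp hn t k
  have hi1 : Integrable (fun ω => M.expReward (M.trueParam ω) (oracle (M.trueParam ω)))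
    (law A K) := integrable_expReward ho integrable_trueParam hθ
  have hi2 : Integrable (fun ω => M.expReward (M.trueParam ω) (M.action oracle t k ω))
    (law A K) := integrable_expReward ho integrable_trueParam hsm
  have hi3 : Integrable (fun ω => M.expReward (M.sample ω (M.stats oracle ω t) t k)
    (M.action oracle t k ω)) (law A K) := integrable_expReward ho hsi hsm
  have hi4 : Integrable (fun ω => ∑ i, if i ∈ M.action oracle t k ω then
      |M.sample ω (M.stats oracle ω t) t k i - M.trueParam ω i| else 0) (law A K) := by
    exact integrable_finsetSum _ fun i _ =>
      integrable_ite (fun ω => i ∈ M.action oracle t k ω) ((hsi i).sub (integrable_trueParam i)).abs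
        (hsm (ho.measurableSet_mem i))
  refine ⟨hi1.sub hi2, hi4, ?_⟩
  have hG : AEStronglyMeasurable (fun θ => M.expReward θ (oracle θ))
      ((law A K).map fun ω => M.trueParam ω) := by
    simp only [expReward_eq_sum_ite]
    refine (Finset.measurable_sum _ fun i _ => Measurable.ite (ho.measurableSet_mem i)
      ((M.model.continuous_meanReward _).measurable.comp (measurable_pi_apply i))
      measurable_const).aestronglyMeasurable
  -- Both sides integrate the same function `θ ↦ f_θ (oracle θ)` of variables with equal laws. The
  -- regret then compares one super-arm under two parameters, so the Lipschitz bound applies.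
  have heq : ∫ ω, M.expReward (M.trueParam ω) (oracle (M.trueParam ω)) ∂(law A K) =
      ∫ ω, M.expReward (M.sample ω (M.stats oracle ω t) t k) (M.action oracle t k ω)
        ∂(law A K) := by
    have h1 := integral_map hθ.aemeasurable hG
    rw [← map_sample_eq_map_trueParam ho hp hn t k] at hG h1
    exact h1.symm.trans (integral_map hsm.aemeasurable hG)
  rw [integral_sub hi1 hi2, heq, ← integral_sub hi3 hi2]
  refine integral_mono (hi3.sub hi2) hi4 fun ω => ?_
  refine (le_abs_self _).trans ((abs_expReward_sub_le _ _ _).trans (le_of_eq ?_))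
  rw [← Finset.sum_filter]
  simp

lemma integrable_regret (ho : M.IsOracle oracle) (hp : ∀ i, 0 < M.priorSD i)
    (hn : ∀ i, 0 < M.noiseSD i) (T : ℕ) (k : Fin K) :
    Integrable (M.regret oracle T k) (law A K) :=
  integrable_finsetSum _ fun t _ => (integrable_and_integral_regret_step_le ho hp hn t k).1

/-- The level `L` is left free. The first term collects the posterior widths, the second the excess
of at most `8 * exp (-L)` for each agent, step and base arm: two Gaussians, each contributing at
most `4`. -/
theorem sum_bayesRegret_le (ho : M.IsOracle oracle) (hp : ∀ i, 0 < M.priorSD i)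
    (hn : ∀ i, 0 < M.noiseSD i ∧ M.noiseSD i ≤ 1) (T : ℕ) {L : ℝ} (hL : 0 ≤ L) :
    ∑ k : Fin K, M.bayesRegret oracle T k ≤
      2 * L * (Fintype.card A * (K + 2 * √((T : ℝ) * K))) +
        8 * (Fintype.card A * (T * K * Real.exp (-L))) := by
  have hn' (i) := (hn i).1
  set B : ℕ → Fin K → Outcome A K → ℝ := fun t k ω => ∑ i,
    if i ∈ M.action oracle t k ω then
      |M.sample ω (M.stats oracle ω t) t k i - M.trueParam ω i| else 0 with hB
  set E : ℕ → Fin K → A → Outcome A K → ℝ := fun t k i ω =>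
    (Real.exp (ω (.post t k i)) + Real.exp (-ω (.post t k i))) +
      (Real.exp (M.zscore (M.stats oracle ω t) (M.trueParam ω) i) +
        Real.exp (-M.zscore (M.stats oracle ω t) (M.trueParam ω) i)) with hE
  have hEint (t k i) : Integrable (E t k i) (law A K) :=
    (integrable_exp_add_exp_neg (hasLaw_post t k i)).add
      (integrable_exp_add_exp_neg (hasLaw_zscore ho hp hn' t i))
  have hEle (t k i) : ∫ ω, E t k i ω ∂(law A K) ≤ 8 := by
    have h1 := integral_exp_add_exp_neg (hasLaw_post (K := K) t k i)
    have h2 := integral_exp_add_exp_neg (hasLaw_zscore (K := K) ho hp hn' t i)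
    simp only [hE]
    rw [integral_add (integrable_exp_add_exp_neg (hasLaw_post t k i))
      (integrable_exp_add_exp_neg (hasLaw_zscore ho hp hn' t i))]
    linarith
  have hEpos (t k i ω) : 0 ≤ E t k i ω := by simp only [hE]; positivity
  have hBint (t k) : Integrable (B t k) (law A K) :=
    (integrable_and_integral_regret_step_le ho hp hn' t k).2.1
  have hreg : ∑ k : Fin K, M.bayesRegret oracle T k ≤
      ∫ ω, ∑ k, ∑ t ∈ Finset.range T, B t k ω ∂(law A K) := by
    rw [integral_finsetSum _ fun k _ => integrable_finsetSum _ fun t _ => hBint t k]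
    refine Finset.sum_le_sum fun k _ => ?_
    rw [integral_finsetSum _ fun t _ => hBint t k]
    unfold bayesRegret regret
    rw [integral_finsetSum _ fun t _ => (integrable_and_integral_regret_step_le ho hp hn' t k).1]
    exact Finset.sum_le_sum fun t _ => (integrable_and_integral_regret_step_le ho hp hn' t k).2.2
  -- The widths are summed on each trajectory, so their dependence on the actions is harmless. In
  -- the excess the indicator of being played is dropped, which leaves expectations of Gaussians
  -- alone.
  have hpoint (ω : Outcome A K) : ∑ k, ∑ t ∈ Finset.range T, B t k ω ≤
      2 * L * (Fintype.card A * (K + 2 * √((T : ℝ) * K))) +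
        Real.exp (-L) * ∑ k, ∑ t ∈ Finset.range T, ∑ i, E t k i ω := by
    have h1 (t k) : B t k ω ≤ 2 * L * (∑ i, if i ∈ M.action oracle t k ω then
        √(M.postVar (M.stats oracle ω t) i) else 0) + Real.exp (-L) * ∑ i, E t k i ω := by
      rw [Finset.mul_sum, Finset.mul_sum, ← Finset.sum_add_distrib]
      refine Finset.sum_le_sum fun i _ => ?_
      split_ifs
      · exact abs_sample_sub_trueParam_le hp hn ω t k i L
      · have := hEpos t k i ω
        positivity
    refine (Finset.sum_le_sum fun k _ => Finset.sum_le_sum fun t _ => h1 t k).trans ?_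
    simp only [Finset.sum_add_distrib, ← Finset.mul_sum]
    refine add_le_add_left (mul_le_mul_of_nonneg_left ?_ (by positivity)) _
    -- The sum over base arms is moved outermost, since the width bound is per arm over all steps
    -- and agents.
    rw [Finset.sum_comm]
    simp only [fun t => Finset.sum_comm (s := (Finset.univ : Finset (Fin K)))
      (t := (Finset.univ : Finset A)) (f := fun k i => if i ∈ M.action oracle t k ω then
        √(M.postVar (M.stats oracle ω t) i) else 0)]
    rw [Finset.sum_comm]
    refine (Finset.sum_le_sum fun i _ =>
      sum_sqrt_postVar_le (hn i).1 (hn i).2 ω T).trans (le_of_eq ?_)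
    rw [Finset.sum_const, nsmul_eq_mul, Finset.card_univ]
  have hEsum : Integrable (fun ω => ∑ k, ∑ t ∈ Finset.range T, ∑ i, E t k i ω) (law A K) :=
    integrable_finsetSum _ fun k _ => integrable_finsetSum _ fun t _ =>
      integrable_finsetSum _ fun i _ => hEint t k i
  have hEsumle : ∫ ω, ∑ k, ∑ t ∈ Finset.range T, ∑ i, E t k i ω ∂(law A K) ≤
      8 * (Fintype.card A * (T * K)) := by
    rw [integral_finsetSum _ fun k _ => integrable_finsetSum _ fun t _ =>
      integrable_finsetSum _ fun i _ => hEint t k i]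
    calc _ ≤ ∑ _k : Fin K, ∑ _t ∈ Finset.range T, ∑ _i : A, (8 : ℝ) := by
          refine Finset.sum_le_sum fun k _ => ?_
          rw [integral_finsetSum _ fun t _ => integrable_finsetSum _ fun i _ => hEint t k i]
          refine Finset.sum_le_sum fun t _ => ?_
          rw [integral_finsetSum _ fun i _ => hEint t k i]
          exact Finset.sum_le_sum fun i _ => hEle t k i
      _ = _ := by simp; ring
  calc _ ≤ _ := hreg
    _ ≤ ∫ ω, (2 * L * (Fintype.card A * (K + 2 * √((T : ℝ) * K))) +
        Real.exp (-L) * ∑ k, ∑ t ∈ Finset.range T, ∑ i, E t k i ω) ∂(law A K) :=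
      integral_mono (integrable_finsetSum _ fun k _ => integrable_finsetSum _ fun t _ => hBint t k)
        ((integrable_const _).add (hEsum.const_mul _)) hpoint
    _ = 2 * L * (Fintype.card A * (K + 2 * √((T : ℝ) * K))) +
        Real.exp (-L) * ∫ ω, ∑ k, ∑ t ∈ Finset.range T, ∑ i, E t k i ω ∂(law A K) := by
      rw [integral_add (integrable_const _) (hEsum.const_mul _),
        integral_const_mul (Real.exp (-L))]
      simp
    _ ≤ 2 * L * (Fintype.card A * (K + 2 * √((T : ℝ) * K))) +
        Real.exp (-L) * (8 * (Fintype.card A * (T * K))) := by gcongr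
    _ = _ := by ring

end SemiBandit
end FleetRouting
end

theorem mainTheorem2 :
    ∃ (C : ℝ) (p : ℕ), ∀ (V : Type*) (G : FleetRouting.RoadNetwork V)
      (M : FleetRouting.SemiBandit G.Edge) (oracle : (G.Edge → ℝ) → Finset G.Edge) (K T : ℕ),
      M.arms.Nonempty → M.arms ⊆ G.pathArms →
      (∀ e, 0 < M.priorSD e) → (∀ e, 0 < M.noiseSD e ∧ M.noiseSD e ≤ 1) →
      M.IsOracle oracle →
      (∀ k : Fin K, Integrable (M.regret oracle T k) (FleetRouting.law G.Edge K)) ∧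
      ∑ k : Fin K, M.bayesRegret oracle T k ≤
        C * (1 + Real.log ((T : ℝ) * K)) ^ p *
          ((G.edges.card : ℝ) * K + (G.edges.card : ℝ) * √((T : ℝ) * K)) := by
  -- With `L = log (T * K)` the bound is `|E|` times `2 * L * K + 4 * L * √(T * K) + 8 * K`. The
  -- last summand dictates `C = 8`, and a single logarithm gives `p = 1`.
  refine ⟨8, 1, fun V G M oracle K T _ _ hp hn ho =>
    ⟨fun k => FleetRouting.SemiBandit.integrable_regret ho hp (fun i => (hn i).1) T k, ?_⟩⟩
  have hL : 0 ≤ Real.log ((T : ℝ) * K) := by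
    rw [← Nat.cast_mul]
    exact Real.log_natCast_nonneg _
  refine (FleetRouting.SemiBandit.sum_bayesRegret_le ho hp hn T hL).trans ?_
  have hd : (Fintype.card G.Edge : ℝ) = G.edges.card := by rw [Fintype.card_coe]
  rw [hd, pow_one]
  have hexp := FleetRouting.mul_exp_neg_log_le T K
  have h1 : (G.edges.card : ℝ) * (T * K * Real.exp (-Real.log ((T : ℝ) * K))) ≤
      G.edges.card * K := mul_le_mul_of_nonneg_left hexp (Nat.cast_nonneg _)
  have h2 : (0 : ℝ) ≤ G.edges.card * K := by positivity
  have h3 : (0 : ℝ) ≤ G.edges.card * √((T : ℝ) * K) := by positivity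
  have h4 := mul_nonneg hL h2
  have h5 := mul_nonneg hL h3
  nlinarith
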